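/- Theorem. Let $G$ be a finite simple directed graph on $n$ vertices, that is, $G$ has no loops and at most one edge between any two vertices (so no directed cycle of length two). Suppose that no vertex of $G$ has in-degree zero, and put $\tau(v)=\lceil(\deg^{\mathrm{in}}(v)+1)/2\rceil$ for every vertex $v$, where $\deg^{\mathrm{in}}(v)$ is the in-degree of $v$. A set $M$ of vertices is called a dynamic monopoly for $(G,\tau)$ if the vertex set of $G$ can be partitioned into (possibly empty) sets $D_0\cup D_1\cup\dots\cup D_t$ such that $D_0=M$ and, for every $i\ge 1$ and every $v\in D_i$, the number of edges from $D_0\cup\dots\cup D_{i-1}$ to $v$ is at least $\tau(v)$. Then the smallest size of a dynamic monopoly for $(G,\tau)$ is at most $\lfloor n/2\rfloor$; that is, there is a dynamic monopoly for $(G,\tau)$ with at most $\lfloor n/2\rfloor$ vertices. -/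

import Mathlib

namespace Digraph

/-- A directed graph is simple if it has no loop and at most one edge between any two
vertices; in particular it has no directed cycle of length two. -/
structure IsSimple {V : Type*} (G : Digraph V) : Prop where
  loopless : ∀ v, ¬ G.Adj v v
  no_two_cycle : ∀ u v, G.Adj u v → ¬ G.Adj v u

open Classical in
/-- The number of edges of `G` from the vertex set `S` to the vertex `v`. -/
noncomputable def edgesInto {V : Type*} (G : Digraph V) (S : Finset V) (v : V) : ℕ :=
  (S.filter fun u => G.Adj u v).card

/-- The in-degree of `v`. -/
noncomputable def inDegree {V : Type*} [Fintype V] (G : Digraph V) (v : V) : ℕ :=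
  G.edgesInto Finset.univ v

/-- The strict majority threshold assignment `v ↦ ⌈(deg^in(v) + 1) / 2⌉`. -/
noncomputable def strictMajority {V : Type*} [Fintype V] (G : Digraph V) (v : V) : ℕ :=
  ⌈((G.inDegree v : ℚ) + 1) / 2⌉₊

/-- On a vertex of positive in-degree the strict majority threshold is at most the in-degree. -/
theorem strictMajority_le_inDegree {V : Type*} [Fintype V] (G : Digraph V) (v : V)
    (h : 1 ≤ G.inDegree v) : G.strictMajority v ≤ G.inDegree v := by
  have h' : (1 : ℚ) ≤ (G.inDegree v : ℚ) := by exact_mod_cast h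
  exact Nat.ceil_le.mpr (by linarith)

open Classical in
/-- `M` is a dynamic monopoly for `(G, τ)`: the vertex set is partitioned into
`D 0, …, D t` with `D 0 = M`, and each vertex of `D i` with `1 ≤ i` receives at least
`τ v` edges from `D 0 ∪ … ∪ D (i - 1)`. The values `D i` with `i > t` play no role. -/
def IsDynamicMonopoly {V : Type*} [Fintype V] (G : Digraph V) (τ : V → ℕ)
    (M : Finset V) : Prop :=
  ∃ (t : ℕ) (D : ℕ → Finset V),
    D 0 = M ∧
    (∀ v, ∃! i, i ≤ t ∧ v ∈ D i) ∧
    ∀ i, 1 ≤ i → i ≤ t → ∀ v ∈ D i,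
      τ v ≤ G.edgesInto ((Finset.range i).biUnion D) v

end Digraph

open Relation

namespace Digraph

/-! ### Minimal sets in which every vertex has an in-neighbour -/

section Core

variable {V : Type*} {G : Digraph V}

/-! Two-colour and rank the vertices so that each has fewer than half of its in-neighbours in its
own colour at no larger rank. Activating one class by decreasing rank then gives every vertex a
strict majority, so both classes are monopolies and the smaller has at most `n / 2` vertices.

For existence (`exists_isRankedColoring`), leave as few vertices uncoloured as possible. At a hole
both colours occupy exactly half of the in-neighbours, so the hole can move to any in-neighbour: the
family `IsShiftFamily`.

Such a family is impossible (`IsShiftFamily.not_mem`). Rotating the hole around an induced cycle `Z`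
makes the rest of `Z` monochromatic. Hence the vertices reachable from `Z` only through `u` contain
another induced cycle, from which a strictly smaller set of this kind arises: an infinite descent.
-/

/-- A nonempty set in which every vertex has an in-neighbour. -/
structure IsCore (G : Digraph V) (Z : Set V) : Prop where
  nonempty : Z.Nonempty
  exists_adj : ∀ z ∈ Z, ∃ w ∈ Z, G.Adj w z

theorem IsCore.exists_minimal_subset [Finite V] {E : Set V} (hE : G.IsCore E) :
    ∃ Z ⊆ E, Minimal G.IsCore Z := by
  obtain ⟨Z, hZE, hZ⟩ := (Set.toFinite {Z : Set V | G.IsCore Z}).exists_le_minimal hE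
  exact ⟨Z, hZE, hZ⟩

/-- A minimal core is an induced directed cycle: it carries a predecessor function. -/
theorem exists_pred_of_minimal_isCore [Finite V] (hG : G.IsSimple) {Z : Set V}
    (hZ : Minimal G.IsCore Z) :
    ∃ p : V → V, (∀ z ∈ Z, p z ∈ Z) ∧ (∀ z ∈ Z, G.Adj (p z) z) ∧
      (∀ z ∈ Z, ∀ w ∈ Z, G.Adj w z → w = p z) ∧
      ∀ z ∈ Z, ∀ w ∈ Z, ∃ k, p^[k] z = w := by
  classical
  have hex : ∀ z, ∃ w, z ∈ Z → w ∈ Z ∧ G.Adj w z := fun z => by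
    by_cases hz : z ∈ Z
    · obtain ⟨w, hw, hwz⟩ := hZ.prop.exists_adj z hz
      exact ⟨w, fun _ => ⟨hw, hwz⟩⟩
    · exact ⟨z, fun h => absurd h hz⟩
  choose p hp using hex
  have hpZ : ∀ z ∈ Z, p z ∈ Z := fun z hz => (hp z hz).1
  -- The image is again a core, so minimality makes `p` surjective on the finite set `Z`, hence
  -- injective.
  have himage : Z ⊆ p '' Z := by
    refine hZ.le_of_le ⟨hZ.prop.nonempty.image p, ?_⟩ (by rintro _ ⟨z, hz, rfl⟩; exact hpZ z hz)
    rintro _ ⟨z, hz, rfl⟩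
    exact ⟨p (p z), ⟨p z, hpZ z hz, rfl⟩, (hp _ (hpZ z hz)).2⟩
  have hinj : Set.InjOn p Z := by
    have hsurj : Function.Surjective (Set.MapsTo.restrict p Z Z hpZ) := by
      rintro ⟨z, hz⟩
      obtain ⟨w, hw, rfl⟩ := himage hz
      exact ⟨⟨w, hw⟩, rfl⟩
    intro a ha b hb hab
    have := Finite.injective_iff_surjective.mpr hsurj
      (a₁ := ⟨a, ha⟩) (a₂ := ⟨b, hb⟩) (Subtype.ext hab)
    exact congrArg Subtype.val this
  refine ⟨p, hpZ, fun z hz => (hp z hz).2, ?_, ?_⟩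
  · intro z hz w hw hwz
    by_contra hne
    have hzp : z ≠ p z := fun h => hG.loopless z (by simpa [← h] using (hp z hz).2)
    -- With a chord `w → z`, the vertex `p z` is dispensable: by injectivity only `z` has it as
    -- chosen predecessor.
    have hcore : G.IsCore (Z \ {p z}) := by
      refine ⟨⟨z, hz, hzp⟩, ?_⟩
      rintro v ⟨hv, -⟩
      by_cases hvz : v = z
      · exact ⟨w, ⟨hw, hne⟩, hvz ▸ hwz⟩
      · exact ⟨p v, ⟨hpZ v hv, fun h => hvz (hinj hv hz h)⟩, (hp v hv).2⟩
    exact (hZ.le_of_le hcore Set.sdiff_subset (hpZ z hz)).2 rfl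
  · intro z hz w hw
    have hmem : ∀ k, p^[k] z ∈ Z := fun k => by
      induction k with
      | zero => exact hz
      | succ k ih => rw [Function.iterate_succ_apply']; exact hpZ _ ih
    have hcore : G.IsCore (Set.range fun k => p^[k] z) := by
      refine ⟨⟨z, 0, rfl⟩, ?_⟩
      rintro _ ⟨k, rfl⟩
      refine ⟨p (p^[k] z), ⟨k + 1, Function.iterate_succ_apply' p k z⟩, (hp _ (hmem k)).2⟩
    exact hZ.le_of_le hcore (by rintro _ ⟨k, rfl⟩; exact hmem k) hw

theorem exists_ne_ne_of_minimal_isCore [Finite V] (hG : G.IsSimple) {Z : Set V}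
    (hZ : Minimal G.IsCore Z) (u v : V) : ∃ z ∈ Z, z ≠ u ∧ z ≠ v := by
  obtain ⟨p, hpZ, hp, -, -⟩ := exists_pred_of_minimal_isCore hG hZ
  obtain ⟨z, hz⟩ := hZ.prop.nonempty
  have h1 : p z ≠ z := fun h => hG.loopless z (by simpa [h] using hp z hz)
  have h2 : p (p z) ≠ p z := fun h =>
    hG.loopless (p z) (by simpa [h] using hp _ (hpZ z hz))
  have h3 : p (p z) ≠ z := fun h =>
    hG.no_two_cycle _ _ (hp z hz) (by simpa [h] using hp _ (hpZ z hz))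
  by_contra! hcon
  have c1 := hcon z hz
  have c2 := hcon (p z) (hpZ z hz)
  have c3 := hcon (p (p z)) (hpZ _ (hpZ z hz))
  by_cases e1 : z = u
  · exact h2 ((c3 fun h => h3 (h.trans e1.symm)).trans (c2 fun h => h1 (h.trans e1.symm)).symm)
  · by_cases e2 : p z = u
    · exact h3 ((c3 fun h => h2 (h.trans e2.symm)).trans (c1 e1).symm)
    · exact h1 ((c2 e2).trans (c1 e1).symm)

/-- Reachability by directed walks whose vertices after the first one avoid `Z`. -/
abbrev ReachOff (G : Digraph V) (Z : Set V) : V → V → Prop :=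
  ReflTransGen fun a b => G.Adj a b ∧ b ∉ Z

theorem ReachOff.eq_or_notMem {Z : Set V} {z q : V} (h : G.ReachOff Z z q) :
    q = z ∨ q ∉ Z := by
  cases h with
  | refl => exact Or.inl rfl
  | tail _ h => exact Or.inr h.2

theorem exists_reachOff {Z : Set V} {z e : V} (hz : z ∈ Z) (h : ReflTransGen G.Adj z e) :
    ∃ a ∈ Z, G.ReachOff Z a e := by
  induction h with
  | refl => exact ⟨z, hz, .refl⟩
  | @tail q e _ hqe ih =>
    by_cases he : e ∈ Z
    · exact ⟨e, he, .refl⟩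
    · obtain ⟨a, ha, haq⟩ := ih
      exact ⟨a, ha, haq.tail ⟨hqe, he⟩⟩

/-- The vertices of `C` that can be reached from `Z` only through `u` as last vertex of `Z`. -/
def exclusiveReach (G : Digraph V) (C Z : Set V) (u : V) : Set V :=
  {e | e ∈ C ∧ ∀ z ∈ Z, G.ReachOff Z z e → z = u}

/-- Some `a ∈ Z'` reaches `u` off `Z'`; any other `u' ∈ Z'` works. The vertex `u` drops out because
of `a`. If a vertex `e` exclusive to `u'` were reached from `z ≠ u` in `Z`, the walk `a → u → z → e`
off `Z'` would force `a = u'`. -/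
theorem exists_exclusiveReach_ssubset [Finite V] (hG : G.IsSimple) {C Z Z' : Set V} {u : V}
    (hstrong : ∀ a ∈ C, ∀ b ∈ C, ReflTransGen G.Adj a b)
    (hZ : Minimal G.IsCore Z) (hZC : Z ⊆ C) (hu : u ∈ Z) (hZ' : Minimal G.IsCore Z')
    (hsub : Z' ⊆ G.exclusiveReach C Z u) :
    ∃ u' ∈ Z', G.exclusiveReach C Z' u' ⊂ G.exclusiveReach C Z u := by
  obtain ⟨b, hb⟩ := hZ'.prop.nonempty
  obtain ⟨a, ha, hau⟩ := exists_reachOff hb (hstrong b (hsub hb).1 u (hZC hu))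
  obtain ⟨u', hu', hne, -⟩ := exists_ne_ne_of_minimal_isCore hG hZ' a a
  refine ⟨u', hu', ?_, fun h => hne ((h ⟨hZC hu, fun z hz hzu => ?_⟩).2 a ha hau).symm⟩
  · rintro e ⟨heC, he⟩
    refine ⟨heC, fun z hz hze => ?_⟩
    by_contra hzu
    have huz : G.ReachOff Z' u z := by
      by_contra hcon
      -- `Z'` meets `Z` at most in `u`, so the part of `Z` not reached from `u` is closed under
      -- predecessors in `Z`, yet misses `u`.
      have hcore : G.IsCore {w ∈ Z | ¬ G.ReachOff Z' u w} := by
        refine ⟨⟨z, hz, hcon⟩, ?_⟩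
        rintro w ⟨hw, hwu⟩
        obtain ⟨q, hq, hqw⟩ := hZ.prop.exists_adj w hw
        refine ⟨q, ⟨hq, fun huq => hwu ?_⟩, hqw⟩
        refine huq.tail ⟨hqw, fun hwZ' => hwu ?_⟩
        rw [(hsub hwZ').2 w hw .refl]
      exact (hZ.le_of_le hcore (Set.sep_subset _ _) hu).2 .refl
    have hze' : G.ReachOff Z' z e := by
      clear he heC
      induction hze with
      | refl => exact .refl
      | tail h1 h2 ih =>
        exact ih.tail ⟨h2.1, fun hmem => hzu ((hsub hmem).2 z hz (h1.tail h2))⟩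
    exact hne (he a ha ((hau.trans huz).trans hze')).symm
  · exact (hzu.eq_or_notMem.resolve_right (not_not.mpr hu)).symm

/-- A vertex with inclusion-minimal ancestor set among the ancestors of `u` lies in a source strong
component. -/
theorem exists_terminal_component [Finite V] (G : Digraph V) (u : V) :
    ∃ v, ReflTransGen G.Adj v u ∧ ∀ w, ReflTransGen G.Adj w v →
      ReflTransGen G.Adj v w := by
  obtain ⟨v, hv, hmin⟩ := (Set.toFinite {v | ReflTransGen G.Adj v u}).exists_minimalFor
    (fun v => {w | ReflTransGen G.Adj w v}) _ ⟨u, .refl⟩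
  exact ⟨v, hv, fun w hw => hmin (hw.trans hv) (fun x hx => hx.trans hw) .refl⟩

end Core

/-! ### Moving the hole of a partial two-colouring -/

section Shift

variable {V : Type*} [DecidableEq V] {G : Digraph V}

/-- Move the hole from `u` to `x`: `u` takes the colour of `x`, which becomes uncoloured. -/
def shiftHole (c : V → Option Bool) (u x : V) : V → Option Bool :=
  Function.update (Function.update c x none) u (c x)

theorem shiftHole_hole (c : V → Option Bool) (u x : V) : shiftHole c u x u = c x := by
  simp [shiftHole]

theorem shiftHole_of_ne (c : V → Option Bool) {u x v : V} (hu : v ≠ u) (hx : v ≠ x) :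
    shiftHole c u x v = c v := by
  simp [shiftHole, hu, hx]

/-- A family of partial colourings with a marked hole, closed under moving the hole to an
in-neighbour, such that both colours occur around each hole and the colour of one
in-neighbour is determined by the colours of the others. -/
structure IsShiftFamily (G : Digraph V) (S : V → (V → Option Bool) → Prop) : Prop where
  shift : ∀ u c x, S u c → G.Adj x u → S x (shiftHole c u x)
  exists_color : ∀ u c, S u c → ∀ b, ∃ y, G.Adj y u ∧ c y = some b
  determined : ∀ u c c' x, S u c → S u c' → G.Adj x u →
    (∀ w, G.Adj w u → w ≠ x → c w = c' w) → c x = c' x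
  colored : ∀ u c x, S u c → G.Adj x u → c x ≠ none

variable {S : V → (V → Option Bool) → Prop}

theorem IsShiftFamily.exists_of_reach (hS : G.IsShiftFamily S) {u v : V}
    {c : V → Option Bool} (h : S u c) (hvu : ReflTransGen G.Adj v u) : ∃ c', S v c' := by
  induction hvu using ReflTransGen.head_induction_on with
  | refl => exact ⟨c, h⟩
  | head hab _ ih =>
    obtain ⟨c', hc'⟩ := ih
    exact ⟨_, hS.shift _ _ _ hc' hab⟩

/-- The hole is carried backwards along the walk, which meets `Z` at most in its two ends, so other
colours on `Z` survive. -/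
theorem IsShiftFamily.exists_of_reachOff (hS : G.IsShiftFamily S) {Z : Set V} {z y : V}
    (hzy : G.ReachOff Z z y) :
    ∀ c, S y c → ∃ c', S z c' ∧ ∀ v ∈ Z, v ≠ z → v ≠ y → c' v = c v := by
  induction hzy with
  | refl => exact fun c hc => ⟨c, hc, fun _ _ _ _ => rfl⟩
  | @tail q y hzq hqy ih =>
    intro c hc
    obtain ⟨c', hc', h'⟩ := ih _ (hS.shift _ _ _ hc hqy.1)
    refine ⟨c', hc', fun v hv hvz hvy => ?_⟩
    have hvq : v ≠ q := by
      rintro rfl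
      exact (ReachOff.eq_or_notMem hzq).elim hvz (fun h => h hv)
    rw [h' v hv hvz hvq, shiftHole_of_ne c hvy hvq]

/-- If the hole lies on an induced cycle, the rest of the cycle is monochromatic. -/
theorem IsShiftFamily.monochromatic [Finite V] (hS : G.IsShiftFamily S) (hG : G.IsSimple) {Z : Set V}
    (hZ : Minimal G.IsCore Z) {u : V} (hu : u ∈ Z) {c : V → Option Bool} (hc : S u c) :
    ∃ b, ∀ z ∈ Z, z ≠ u → c z = some b := by
  obtain ⟨p, hpZ, hp, huniq, htrans⟩ := exists_pred_of_minimal_isCore hG hZ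
  have hne1 : ∀ z ∈ Z, p z ≠ z := fun z hz h => hG.loopless z (by simpa [h] using hp z hz)
  have hne2 : ∀ z ∈ Z, p (p z) ≠ z := fun z hz h =>
    hG.no_two_cycle _ _ (hp z hz) (by simpa [h] using hp _ (hpZ z hz))
  have hmem : ∀ z ∈ Z, ∀ k, p^[k] z ∈ Z := fun z hz k => by
    induction k with
    | zero => exact hz
    | succ k ih => rw [Function.iterate_succ_apply']; exact hpZ _ ih
  -- moving the hole `k` steps backwards along the cycle
  have hmove : ∀ z ∈ Z, ∀ c, S z c → ∀ k < Function.minimalPeriod p z,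
      ∃ c', S (p^[k] z) c' ∧ (∀ v, (∀ i ≤ k, v ≠ p^[i] z) → c' v = c v) ∧
        ∀ i < k, c' (p^[i] z) = c (p^[i + 1] z) := by
    intro z hz c hc k
    induction k with
    | zero => exact fun _ => ⟨c, hc, fun _ _ => rfl, fun i hi => absurd hi (Nat.not_lt_zero i)⟩
    | succ k ih =>
      intro hk
      obtain ⟨c', hc', hout, hin⟩ := ih (by omega)
      have hdist : ∀ i ≤ k + 1, ∀ j ≤ k + 1, p^[i] z = p^[j] z → i = j := fun i hi j hj h =>
        Function.iterate_injOn_Iio_minimalPeriod (Set.mem_Iio.mpr (by omega))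
          (Set.mem_Iio.mpr (by omega)) h
      have hadj : G.Adj (p^[k + 1] z) (p^[k] z) := by
        rw [Function.iterate_succ_apply']; exact hp _ (hmem z hz k)
      refine ⟨_, hS.shift _ _ _ hc' hadj, fun v hv => ?_, fun i hi => ?_⟩
      · rw [shiftHole_of_ne _ (hv k (by omega)) (hv (k + 1) le_rfl)]
        exact hout v fun i hi => hv i (by omega)
      · rcases Nat.lt_succ_iff_lt_or_eq.mp hi with hik | rfl
        · rw [shiftHole_of_ne, hin i hik]
          · exact fun h => by have := hdist _ (by omega) _ (by omega) h; omega
          · exact fun h => by have := hdist _ (by omega) _ (by omega) h; omega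
        · rw [shiftHole_hole]
          refine hout _ fun j hj h => ?_
          have := hdist _ (by omega) _ (by omega) h
          omega
  have hper : ∀ z ∈ Z, 3 ≤ Function.minimalPeriod p z := by
    intro z hz
    obtain ⟨k, hk⟩ := htrans _ (hpZ z hz) z hz
    have hpos : 0 < Function.minimalPeriod p z :=
      Function.minimalPeriod_pos_of_mem_periodicPts
        ⟨k + 1, Nat.succ_pos k, by rw [Function.IsPeriodicPt, Function.IsFixedPt,
          Function.iterate_succ_apply]; exact hk⟩
    have hfix := Function.iterate_minimalPeriod (f := p) (x := z)
    by_contra! hlt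
    obtain h | h : Function.minimalPeriod p z = 1 ∨ Function.minimalPeriod p z = 2 := by omega
    · rw [h] at hfix; exact hne1 z hz hfix
    · rw [h] at hfix; exact hne2 z hz hfix
  -- rotating the colours once around the cycle
  have hpair : ∀ z ∈ Z, ∀ c, S z c → c (p z) = c (p (p z)) := by
    intro z hz c hc
    have hl := hper z hz
    obtain ⟨l, hl'⟩ : ∃ l, Function.minimalPeriod p z = l + 3 := ⟨_, (Nat.sub_add_cancel hl).symm⟩
    obtain ⟨c', hc', hout, hin⟩ := hmove z hz c hc (l + 2) (by omega)
    have hfix : p^[l + 3] z = z := hl' ▸ Function.iterate_minimalPeriod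
    have hdist : ∀ i < l + 3, ∀ j < l + 3, p^[i] z = p^[j] z → i = j := fun i hi j hj h =>
      Function.iterate_injOn_Iio_minimalPeriod (Set.mem_Iio.mpr (by omega))
          (Set.mem_Iio.mpr (by omega)) h
    have hadj : G.Adj z (p^[l + 2] z) := by
      have := hp _ (hmem z hz (l + 2))
      rwa [← Function.iterate_succ_apply' p, hfix] at this
    have hstep := hS.shift _ _ _ hc' hadj
    have hpz : shiftHole c' (p^[l + 2] z) z (p z) = c (p (p z)) := by
      rw [shiftHole_of_ne]
      · exact hin 1 (by omega)
      · exact fun h => by have := hdist 1 (by omega) _ (by omega) h; omega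
      · exact hne1 z hz
    rw [← hpz]
    -- The hole is back at `z`, and only `p z` among its in-neighbours lies on the cycle, so no
    -- other in-neighbour has been recoloured.
    refine hS.determined z _ _ _ hc hstep (hp z hz) fun w hw hwp => ?_
    have hwZ : w ∉ Z := fun h => hwp (huniq z hz w h hw)
    have hwi : ∀ i, w ≠ p^[i] z := fun i h => hwZ (h ▸ hmem z hz i)
    rw [shiftHole_of_ne _ (hwi _) (show w ≠ z from hwi 0), hout w fun i _ => hwi i]
  obtain ⟨b, hb⟩ := Option.ne_none_iff_exists'.mp (hS.colored u c _ hc (hp u hu))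
  have hall : ∀ k, k + 1 < Function.minimalPeriod p u → c (p^[k + 1] u) = some b := by
    intro k
    induction k with
    | zero => exact fun _ => hb
    | succ k ih =>
      intro hk
      obtain ⟨c', hc', hout, -⟩ := hmove u hu c hc k (by omega)
      have h := hpair _ (hmem u hu k) c' hc'
      rw [← Function.iterate_succ_apply' p, ← Function.iterate_succ_apply' p] at h
      have hdist : ∀ i ≤ k + 2, ∀ j ≤ k + 2, p^[i] u = p^[j] u → i = j := fun i hi j hj h =>
        Function.iterate_injOn_Iio_minimalPeriod (Set.mem_Iio.mpr (by omega))
          (Set.mem_Iio.mpr (by omega)) h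
      rw [hout, hout, ih (by omega)] at h
      · exact h.symm
      · exact fun i hi h => by have := hdist _ (by omega) _ (by omega) h; omega
      · exact fun i hi h => by have := hdist _ (by omega) _ (by omega) h; omega
  refine ⟨b, fun z hz hzu => ?_⟩
  obtain ⟨k, rfl⟩ := htrans u hu z hz
  rw [← Function.iterate_mod_minimalPeriod_eq] at hzu ⊢
  have hlt := Nat.mod_lt k (show 0 < Function.minimalPeriod p u by have := hper u hu; omega)
  cases hm : k % Function.minimalPeriod p u with
  | zero => exact absurd (by rw [hm]; rfl) hzu
  | succ m => exact hall m (hm ▸ hlt)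

/-- Only `u` needs an argument. With the hole at `u`, an in-neighbour `y` of the colour absent from
`Z` works: if some other `z ∈ Z` reached `y`, moving the hole through `y` to `z` would leave `u`
with the colour of `y` and a third vertex of `Z` with the old one. -/
theorem IsShiftFamily.isCore_exclusiveReach [Finite V] (hS : G.IsShiftFamily S) (hG : G.IsSimple)
    {C Z : Set V} {u : V} (hclosed : ∀ a b, G.Adj a b → b ∈ C → a ∈ C)
    (hex : ∀ v ∈ C, ∃ c, S v c) (hZ : Minimal G.IsCore Z) (hZC : Z ⊆ C) (hu : u ∈ Z) :
    G.IsCore (G.exclusiveReach C Z u) := by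
  refine ⟨⟨u, hZC hu, fun z hz hzu => ?_⟩, ?_⟩
  · exact (hzu.eq_or_notMem.resolve_right (not_not.mpr hu)).symm
  rintro e ⟨heC, he⟩
  obtain ⟨c, hc⟩ := hex e heC
  by_cases heu : e = u
  · subst heu
    obtain ⟨b, hb⟩ := hS.monochromatic hG hZ hu hc
    obtain ⟨y, hye, hy⟩ := hS.exists_color e c hc (!b)
    have hne : y ≠ e := fun h => hG.loopless e (h ▸ hye)
    have hyZ : y ∉ Z := fun h => by simp [hb y h hne] at hy
    refine ⟨y, ⟨hclosed _ _ hye heC, fun z hz hzy => ?_⟩, hye⟩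
    by_contra hze
    obtain ⟨c', hc', h'⟩ := hS.exists_of_reachOff hzy _ (hS.shift _ _ _ hc hye)
    obtain ⟨v, hv, hve, hvz⟩ := exists_ne_ne_of_minimal_isCore hG hZ e z
    obtain ⟨b', hb'⟩ := hS.monochromatic hG hZ hz hc'
    have hvy : v ≠ y := fun h => hyZ (h ▸ hv)
    have h1 := hb' e hu (Ne.symm hze)
    have h2 := hb' v hv hvz
    rw [h' e hu (Ne.symm hze) hne.symm, shiftHole_hole, hy] at h1
    rw [h' v hv hvz hvy, shiftHole_of_ne _ hve hvy, hb v hv hve, ← h1] at h2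
    simp at h2
  · obtain ⟨q, hqe, -⟩ := hS.exists_color e c hc true
    have heZ : e ∉ Z := fun h => heu (he e h .refl)
    exact ⟨q, ⟨hclosed _ _ hqe heC, fun z hz hzq => he z hz (hzq.tail ⟨hqe, heZ⟩)⟩, hqe⟩

/-- In a simple digraph there is no nonempty shift family. -/
theorem IsShiftFamily.not_mem [Finite V] (hS : G.IsShiftFamily S) (hG : G.IsSimple) (u : V)
    (c : V → Option Bool) : ¬ S u c := by
  intro hc
  obtain ⟨v, hvu, hterm⟩ := G.exists_terminal_component u
  obtain ⟨c, hc⟩ := hS.exists_of_reach hc hvu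
  set C : Set V := {w | ReflTransGen G.Adj w v} with hC
  have hclosed : ∀ a b, G.Adj a b → b ∈ C → a ∈ C := fun a b hab hb => .head hab hb
  have hstrong : ∀ a ∈ C, ∀ b ∈ C, ReflTransGen G.Adj a b := fun a ha b hb =>
    ReflTransGen.trans ha (hterm b hb)
  have hex : ∀ w ∈ C, ∃ c, S w c := fun w hw => hS.exists_of_reach hc hw
  have hcoreC : G.IsCore C := by
    refine ⟨⟨v, .refl⟩, fun z hz => ?_⟩
    obtain ⟨c, hc⟩ := hex z hz
    obtain ⟨q, hq, -⟩ := hS.exists_color z c hc true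
    exact ⟨q, hclosed _ _ hq hz, hq⟩
  have hdescent : ∀ E : Set V, ∀ Z u, Minimal G.IsCore Z → Z ⊆ C → u ∈ Z →
      E = G.exclusiveReach C Z u → False := by
    intro E
    induction E using WellFoundedLT.induction with
    | ind E ih =>
      rintro Z u hZ hZC hu rfl
      obtain ⟨Z', hsub, hZ'⟩ :=
        (hS.isCore_exclusiveReach hG hclosed hex hZ hZC hu).exists_minimal_subset
      obtain ⟨u', hu', hss⟩ := exists_exclusiveReach_ssubset hG hstrong hZ hZC hu hZ' hsub
      exact ih _ hss Z' u' hZ' (fun x hx => (hsub hx).1) hu' rfl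
  obtain ⟨Z, hZC, hZ⟩ := hcoreC.exists_minimal_subset
  obtain ⟨u, hu⟩ := hZ.prop.nonempty
  exact hdescent _ Z u hZ hZC hu rfl

end Shift

/-! ### Ranked partial colourings -/

section Ranked

open Finset

variable {V : Type*} [Fintype V] {G : Digraph V}

open Classical in
/-- Every coloured vertex has fewer than half of its in-neighbours among the vertices of its
own colour and of at most its own rank. -/
def IsRankedColoring (G : Digraph V) (c : V → Option Bool) (r : V → ℕ) : Prop :=
  ∀ v b, c v = some b →
    2 * #{w | G.Adj w v ∧ c w = some b ∧ r w ≤ r v} < G.inDegree v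

open Classical in
theorem inDegree_eq_card (G : Digraph V) (v : V) : G.inDegree v = #{w | G.Adj w v} := rfl

open Classical in
theorem IsRankedColoring.update_none {c : V → Option Bool} {r : V → ℕ}
    (h : G.IsRankedColoring c r) (x : V) :
    G.IsRankedColoring (Function.update c x none) r := by
  intro v b hv
  have hle : ∀ w, Function.update c x none w = some b → c w = some b := fun w hw => by
    by_cases hwx : w = x
    · simp [hwx] at hw
    · simpa [hwx] using hw
  refine lt_of_le_of_lt ?_ (h v b (hle v hv))
  exact Nat.mul_le_mul_left 2 (card_le_card (monotone_filter_right _ fun w _ hw =>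
    ⟨hw.1, hle w hw.2.1, hw.2.2⟩))

open Classical in
theorem IsRankedColoring.exists_update_some {c : V → Option Bool} {r : V → ℕ}
    (h : G.IsRankedColoring c r) (hG : G.IsSimple) {u : V} {b : Bool}
    (hu : 2 * #{w | G.Adj w u ∧ c w = some b} < G.inDegree u) :
    ∃ r', G.IsRankedColoring (Function.update c u (some b)) r' := by
  have hlt : ∀ v, r v < univ.sup r + 1 := fun v => Nat.lt_succ_of_le (le_sup (mem_univ v))
  -- A rank above all others keeps `u` out of every other vertex's count.
  refine ⟨Function.update r u (univ.sup r + 1), fun v b' hv => ?_⟩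
  by_cases hvu : v = u
  · subst hvu
    obtain rfl : b = b' := by simpa using hv
    refine lt_of_le_of_lt ?_ hu
    refine Nat.mul_le_mul_left 2 (card_le_card (monotone_filter_right _ fun w _ => ?_))
    rintro ⟨hwv, hw, -⟩
    have hne : w ≠ v := fun h => hG.loopless v (h ▸ hwv)
    exact ⟨hwv, by simpa [hne] using hw⟩
  · rw [Function.update_of_ne hvu] at hv
    refine lt_of_le_of_lt ?_ (h v b' hv)
    refine Nat.mul_le_mul_left 2 (card_le_card (monotone_filter_right _ fun w _ => ?_))
    rintro ⟨hwv, hw, hr⟩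
    have hne : w ≠ u := by
      rintro rfl
      have := hlt v
      simp [hvu] at hr
      omega
    simp only [ne_eq, hne, not_false_eq_true, Function.update_of_ne, hvu] at hw hr
    exact ⟨hwv, hw, hr⟩

open Classical in
theorem exists_isRankedColoring (hG : G.IsSimple) (hdeg : ∀ v, 1 ≤ G.inDegree v) :
    ∃ c r, G.IsRankedColoring c r ∧ ∀ v, c v ≠ none := by
  obtain ⟨⟨c, r⟩, hcr, hmin⟩ := exists_minimalFor_of_wellFoundedLT
    (fun x : (V → Option Bool) × (V → ℕ) => G.IsRankedColoring x.1 x.2)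
    (fun x => #{v | x.1 v = none}) ⟨(fun _ => none, fun _ => 0), fun v b hv => by simp at hv⟩
  refine ⟨c, r, hcr, fun u hu => ?_⟩
  set m := #{v | c v = none}
  have hle : ∀ c' r', G.IsRankedColoring c' r' → m ≤ #{v | c' v = none} := by
    intro c' r' h
    by_contra! hcon
    exact absurd (hmin (j := (c', r')) h hcon.le) (not_le.mpr hcon)
  -- The rank stays existential because each move of the hole assigns a new one.
  let S : V → (V → Option Bool) → Prop := fun u c =>
    c u = none ∧ #{v | c v = none} = m ∧ ∃ r, G.IsRankedColoring c r
  have hge : ∀ u c, S u c → ∀ b, G.inDegree u ≤ 2 * #{w | G.Adj w u ∧ c w = some b} := by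
    rintro u c ⟨hu, hcm, r, hr⟩ b
    by_contra! hcon
    obtain ⟨r', hr'⟩ := hr.exists_update_some hG hcon
    have h1 := hle _ _ hr'
    have h2 : univ.filter (fun v => Function.update c u (some b) v = none) ⊂
        univ.filter fun v => c v = none := by
      refine ⟨fun v hv => ?_, fun h => ?_⟩
      · by_cases hvu : v = u
        · simpa [hvu] using hu
        · simpa [hvu] using hv
      · have := h (mem_filter.mpr ⟨mem_univ u, hu⟩)
        simp at this
    have := card_lt_card h2
    omega
  have hsum : ∀ u (c : V → Option Bool), #{w | G.Adj w u ∧ c w = some true} +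
      #{w | G.Adj w u ∧ c w = some false} + #{w | G.Adj w u ∧ c w = none} = G.inDegree u := by
    intro u c
    rw [inDegree_eq_card, ← card_union_of_disjoint, ← card_union_of_disjoint]
    · congr 1
      ext w
      rcases hcw : c w with _ | _ | _ <;> simp [hcw]
    · rw [Finset.disjoint_left]; intro w; rcases hcw : c w with _ | _ | _ <;> simp [hcw]
    · rw [Finset.disjoint_left]; intro w; rcases hcw : c w with _ | _ | _ <;> simp [hcw]
  have heq : ∀ u c, S u c → ∀ b, 2 * #{w | G.Adj w u ∧ c w = some b} = G.inDegree u := by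
    intro u c h b
    have h1 := hge u c h true
    have h2 := hge u c h false
    have h3 := hsum u c
    cases b <;> omega
  have hcolored : ∀ u c x, S u c → G.Adj x u → c x ≠ none := by
    intro u c x h hx hcx
    have h1 := hge u c h true
    have h2 := hge u c h false
    have h3 := hsum u c
    have h4 : 0 < #{w | G.Adj w u ∧ c w = none} :=
      card_pos.mpr ⟨x, mem_filter.mpr ⟨mem_univ x, hx, hcx⟩⟩
    omega
  have hS : G.IsShiftFamily S := by
    refine ⟨?_, ?_, ?_, hcolored⟩
    · intro u c x h hx
      obtain ⟨b, hb⟩ := Option.ne_none_iff_exists'.mp (hcolored u c x h hx)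
      have hux : u ≠ x := fun h => hG.loopless u (by simpa [← h] using hx)
      have hcard := heq u c h b
      obtain ⟨hu, hcm, r, hr⟩ := h
      refine ⟨by simp [shiftHole, hux.symm], ?_, ?_⟩
      · have hset : univ.filter (fun v => shiftHole c u x v = none) =
            insert x ((univ.filter fun v => c v = none).erase u) := by
          ext v
          simp only [mem_insert, mem_erase, mem_filter, mem_univ, true_and]
          by_cases hvu : v = u
          · subst hvu; simp [shiftHole, hb, hux]
          · by_cases hvx : v = x
            · subst hvx; simp [shiftHole, hvu]
            · simp [shiftHole, hvu, hvx]
        have hpos : 0 < #{v | c v = none} := card_pos.mpr ⟨u, mem_filter.mpr ⟨mem_univ u, hu⟩⟩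
        rw [hset, card_insert_of_notMem (by simp [hb]),
          card_erase_of_mem (mem_filter.mpr ⟨mem_univ u, hu⟩)]
        omega
      · rw [shiftHole, hb]
        refine (hr.update_none x).exists_update_some hG ?_
        -- Uncolouring `x` brings colour `b` strictly below half at `u`, so `u` can take it.
        have hss : univ.filter (fun w => G.Adj w u ∧ Function.update c x none w = some b) ⊂
            univ.filter fun w => G.Adj w u ∧ c w = some b := by
          refine ⟨fun w hw => ?_, fun hsub => ?_⟩
          · by_cases hwx : w = x
            · simp [hwx] at hw
            · simpa [hwx] using hw
          · have := hsub (mem_filter.mpr ⟨mem_univ x, hx, hb⟩)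
            simp at this
        have := card_lt_card hss
        omega
    · intro u c h b
      have h1 := heq u c h b
      have h2 := hdeg u
      obtain ⟨y, hy⟩ := card_pos.mp (show 0 < #{w | G.Adj w u ∧ c w = some b} by omega)
      exact ⟨y, (mem_filter.mp hy).2⟩
    · intro u c c' x h h' hx hagree
      obtain ⟨b, hb⟩ := Option.ne_none_iff_exists'.mp (hcolored u c x h hx)
      by_contra hne
      have hss : univ.filter (fun w => G.Adj w u ∧ c' w = some b) ⊂
          univ.filter fun w => G.Adj w u ∧ c w = some b := by
        have hb' : c' x ≠ some b := fun h => hne (hb.trans h.symm)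
        refine ⟨fun w hw => ?_, fun hsub => ?_⟩
        · obtain ⟨hwu, hw⟩ := (mem_filter.mp hw).2
          have hwx : w ≠ x := fun h => hb' (h ▸ hw)
          exact mem_filter.mpr ⟨mem_univ w, hwu, (hagree w hwu hwx).trans hw⟩
        · exact hb' (mem_filter.mp (hsub (mem_filter.mpr ⟨mem_univ x, hx, hb⟩))).2.2
      have h1 := card_lt_card hss
      have h2 := heq u c h b
      have h3 := heq u c' h' b
      omega
  exact hS.not_mem hG u c ⟨hu, rfl, r, hcr⟩

open Classical in
/-- Each colour class of a complete ranked colouring is a dynamic monopoly: the other class is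
activated in the order of decreasing rank. -/
theorem IsRankedColoring.isDynamicMonopoly {c : V → Option Bool} {r : V → ℕ}
    (h : G.IsRankedColoring c r) (hc : ∀ v, c v ≠ none) (b : Bool) :
    G.IsDynamicMonopoly G.strictMajority ({v | c v = some b} : Finset V) := by
  have hle : ∀ v, r v ≤ univ.sup r := fun v => le_sup (mem_univ v)
  have hnot : ∀ v, c v ≠ some b → c v = some (!b) := fun v hv => by
    have := hc v
    rcases hcv : c v with _ | _ | _ <;> cases b <;> simp_all
  refine ⟨univ.sup r + 1, fun i => if i = 0 then univ.filter (fun v => c v = some b) else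
    univ.filter fun v => c v = some (!b) ∧ r v + i = univ.sup r + 1, by simp, fun v => ?_, ?_⟩
  · have hv := hle v
    by_cases hb : c v = some b
    · refine ⟨0, by simp [hb], fun i hi => ?_⟩
      by_contra hi0
      simp [hi0, hb] at hi
    · have hb' := hnot v hb
      refine ⟨univ.sup r + 1 - r v, ⟨by omega, ?_⟩, fun i hi => ?_⟩
      · beta_reduce
        rw [if_neg (by omega)]
        exact mem_filter.mpr ⟨mem_univ v, hb', by omega⟩
      · by_cases hi0 : i = 0
        · simp [hi0, hb] at hi
        · simp [hi0] at hi
          omega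
  · intro i hi hit v hv
    beta_reduce at hv
    rw [if_neg (by omega)] at hv
    obtain ⟨hvb, hri⟩ := (mem_filter.mp hv).2
    have hlow := h v _ hvb
    -- An in-neighbour not yet active has the colour of `v` and rank at most `r v`; fewer than half
    -- are of this kind.
    have hcover : G.inDegree v ≤
        G.edgesInto ((Finset.range i).biUnion fun i => if i = 0 then
          univ.filter (fun v => c v = some b) else
          univ.filter fun v => c v = some (!b) ∧ r v + i = univ.sup r + 1) v +
        #{w | G.Adj w v ∧ c w = some (!b) ∧ r w ≤ r v} := by
      rw [inDegree_eq_card, edgesInto]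
      refine (card_le_card fun w hw => ?_).trans (card_union_le _ _)
      have hwv := (mem_filter.mp hw).2
      rw [mem_union]
      by_cases hb : c w = some b
      · refine Or.inl (mem_filter.mpr ⟨mem_biUnion.mpr ⟨0, mem_range.mpr (by omega), ?_⟩, hwv⟩)
        simp [hb]
      · have hb' := hnot w hb
        by_cases hrw : r w ≤ r v
        · exact Or.inr (mem_filter.mpr ⟨mem_univ w, hwv, hb', hrw⟩)
        · have := hle w
          refine Or.inl (mem_filter.mpr ⟨mem_biUnion.mpr ⟨univ.sup r + 1 - r w,
            mem_range.mpr (by omega), ?_⟩, hwv⟩)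
          rw [if_neg (by omega)]
          exact mem_filter.mpr ⟨mem_univ w, hb', by omega⟩
    refine Nat.ceil_le.mpr ?_
    generalize G.edgesInto _ v = a at hcover ⊢
    have h2 : G.inDegree v + 1 ≤ 2 * a := by omega
    have h3 : (G.inDegree v : ℚ) + 1 ≤ 2 * a := by exact_mod_cast h2
    linarith

end Ranked

end Digraph

theorem mainTheorem1 {V : Type*} [Fintype V] (G : Digraph V) (hG : G.IsSimple)
    (hdeg : ∀ v, 1 ≤ G.inDegree v) :
    ∃ M : Finset V, G.IsDynamicMonopoly G.strictMajority M ∧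
      M.card ≤ Fintype.card V / 2 := by
  classical
  obtain ⟨c, r, hcr, hc⟩ := Digraph.exists_isRankedColoring hG hdeg
  have hcard : ({v | c v = some true} : Finset V).card +
      ({v | c v = some false} : Finset V).card = Fintype.card V := by
    rw [← Finset.card_univ, ← Finset.card_union_of_disjoint]
    · congr 1
      ext v
      have := hc v
      rcases hcv : c v with _ | _ | _ <;> simp_all
    · rw [Finset.disjoint_left]; intro v; rcases hcv : c v with _ | _ | _ <;> simp [hcv]
  rcases le_total ({v | c v = some true} : Finset V).card
    ({v | c v = some false} : Finset V).card with hle | hle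
  · exact ⟨_, hcr.isDynamicMonopoly hc true, by omega⟩
  · exact ⟨_, hcr.isDynamicMonopoly hc false, by omega⟩
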